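/- Banach algebras and Banach spaces are complex; Banach algebras need not be unital. Let $\Omega$ be a locally compact Hausdorff space and let $\mathcal U=\{\Omega,(A_t)_{t\in\Omega},\Theta\}$ be a continuous field of Banach algebras, i.e. each $A_t$ is a Banach algebra and $\Theta$ is a subalgebra of $\prod_{t\in\Omega}A_t$ such that (i) $\{x(t):x\in\Theta\}$ is dense in $A_t$ for every $t$; (ii) $t\mapsto\|x(t)\|$ is continuous for every $x\in\Theta$; (iii) if $x\in\prod_t A_t$ and for every $t\in\Omega$ and $\varepsilon>0$ there is $x'\in\Theta$ with $\|x(s)-x'(s)\|\le\varepsilon$ for all $s$ in some neighbourhood of $t$, then $x\in\Theta$. For $Y\subseteq\Omega$ let $\mathcal U|_Y$ be the continuous field over $Y$ with fibres $A_t$ $(t\in Y)$ whose continuous vector fields are those $x\in\prod_{t\in Y}A_t$ such that for every $t_0\in Y$ and $\varepsilon>0$ there is $x'\in\Theta$ with $\|x(t)-x'(t)\|\le\varepsilon$ for all $t\in Y$ near $t_0$. Suppose that $\mathcal U$ is locally trivial: every $t\in\Omega$ has an open neighbourhood $V$ for which there are a Banach algebra $B$ and isometric algebra isomorphisms $\phi_s:A_s\to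 B$ $(s\in V)$ such that a vector field $x$ over $V$ is a continuous vector field of $\mathcal U|_V$ if and only if $s\mapsto\phi_s(x(s))$ is a continuous map $V\to B$. Let $\mathcal A$ be the Banach algebra defined by $\mathcal U$: the set of all $x\in\Theta$ for which $\|x(t)\|$ vanishes at infinity on $\Omega$, with pointwise operations and the norm $\|x\|=\sup_{t\in\Omega}\|x(t)\|$. Suppose that $\mathcal A$ is left or right projective, i.e. that $P=\mathcal A$, as a left (respectively right) Banach module over itself, has the following property: for every left (right) Banach $\mathcal A$-module $Y$, every bounded module homomorphism $\varphi:Y\to P$ that has a right inverse which is a bounded linear operator has a right inverse which is a bounded module homomorphism. Let $\Theta^2$ be the linear span of $\{xy:x,y\in\Theta\}$, and let $\overline{\Theta^2}$ be its closure for uniform convergence on compact subsets of $\Omega$, i.e. the set of $p\in\prod_t A_t$ such that for every compact $K\subseteq\Omega$ and every $\varepsilon>0$ there is $q\in\Theta^2$ with $\|p(t)-q(t)\|\le\varepsilon$ for all $t\in K$. Suppose that there is a continuous field $p\in\Theta\cap\overline{\Theta^2}$ such that $p(t)\ne0$ for all $t\in\Omega$ and $\sup_{s\in\Omega}\|p(s)\|<\infty$.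 Then $\Omega$ is paracompact. -/

import Mathlib

open Filter Topology
open scoped ENNReal

universe u v

/-! ## Banach modules over a (not necessarily unital) complex Banach algebra -/

/-- A left Banach module structure on the Banach space `Y` over the Banach algebra `A`: a jointly
continuous (that is, bounded) bilinear map `A × Y → Y` with `(a b) · y = a · (b · y)`. -/
structure LeftBanachAction (A : Type*) (Y : Type*) [NonUnitalNormedRing A] [NormedSpace ℂ A]
    [NormedAddCommGroup Y] [NormedSpace ℂ Y] where
  act : A →L[ℂ] Y →L[ℂ] Y
  mul_act : ∀ (a b : A) (y : Y), act (a * b) y = act a (act b y)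

/-- A right Banach module structure; `act a y` stands for `y · a`, and `y · (a b) = (y · a) · b`. -/
structure RightBanachAction (A : Type*) (Y : Type*) [NonUnitalNormedRing A] [NormedSpace ℂ A]
    [NormedAddCommGroup Y] [NormedSpace ℂ Y] where
  act : A →L[ℂ] Y →L[ℂ] Y
  act_mul : ∀ (a b : A) (y : Y), act (a * b) y = act b (act a y)

/-- `P` is projective in the category of left Banach `A`-modules: every morphism of modules
`φ : Y → P` that has a right inverse `σ` as a bounded linear operator (such a `φ` is onto, so it is
an epimorphism) has a right inverse `ψ` which is a morphism of modules. Morphisms are the bounded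
module homomorphisms. The test modules `Y` range over the universe of `P` and `A`. -/
def LeftBanachAction.IsProjective {A : Type u} {P : Type v} [NonUnitalNormedRing A] [NormedSpace ℂ A]
    [NormedAddCommGroup P] [NormedSpace ℂ P] (m : LeftBanachAction A P) : Prop :=
  ∀ (Y : Type (max u v)) [NormedAddCommGroup Y] [NormedSpace ℂ Y] [CompleteSpace Y]
    (n : LeftBanachAction A Y) (φ : Y →L[ℂ] P),
    (∀ a y, φ (n.act a y) = m.act a (φ y)) →
    (∃ σ : P →L[ℂ] Y, φ.comp σ = ContinuousLinearMap.id ℂ P) →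
    ∃ ψ : P →L[ℂ] Y, (∀ a x, ψ (m.act a x) = n.act a (ψ x)) ∧
      φ.comp ψ = ContinuousLinearMap.id ℂ P

/-- Projectivity in the category of right Banach `A`-modules. -/
def RightBanachAction.IsProjective {A : Type u} {P : Type v} [NonUnitalNormedRing A] [NormedSpace ℂ A]
    [NormedAddCommGroup P] [NormedSpace ℂ P] (m : RightBanachAction A P) : Prop :=
  ∀ (Y : Type (max u v)) [NormedAddCommGroup Y] [NormedSpace ℂ Y] [CompleteSpace Y]
    (n : RightBanachAction A Y) (φ : Y →L[ℂ] P),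
    (∀ a y, φ (n.act a y) = m.act a (φ y)) →
    (∃ σ : P →L[ℂ] Y, φ.comp σ = ContinuousLinearMap.id ℂ P) →
    ∃ ψ : P →L[ℂ] Y, (∀ a x, ψ (m.act a x) = n.act a (ψ x)) ∧
      φ.comp ψ = ContinuousLinearMap.id ℂ P

section Regular

variable (A : Type*) [NonUnitalNormedRing A] [NormedSpace ℂ A] [IsScalarTower ℂ A A]
  [SMulCommClass ℂ A A]

/-- `A` as a left Banach module over itself. -/
noncomputable def LeftBanachAction.regular : LeftBanachAction A A where
  act := ContinuousLinearMap.mul ℂ A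
  mul_act a b y := by simp [mul_assoc]

/-- `A` as a right Banach module over itself. -/
noncomputable def RightBanachAction.regular : RightBanachAction A A where
  act := (ContinuousLinearMap.mul ℂ A).flip
  act_mul a b y := by simp [mul_assoc]

/-- The Banach algebra `A` is left projective. -/
def IsLeftProjectiveBanachAlgebra [CompleteSpace A] : Prop :=
  (LeftBanachAction.regular A).IsProjective

/-- The Banach algebra `A` is right projective. -/
def IsRightProjectiveBanachAlgebra [CompleteSpace A] : Prop :=
  (RightBanachAction.regular A).IsProjective

end Regular

/-! ## Continuous fields of Banach algebras -/

/-- A continuous field of (complex) Banach algebras over `Ω` with fibres `A t`. The space `Ω` is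
assumed to be locally compact and Hausdorff where the notion is used. -/
structure ContinuousField (Ω : Type*) [TopologicalSpace Ω] (A : Ω → Type*)
    [∀ t, NonUnitalNormedRing (A t)] [∀ t, NormedSpace ℂ (A t)] where
  /-- the algebra of continuous vector fields -/
  Θ : NonUnitalSubalgebra ℂ (∀ t, A t)
  dense_eval : ∀ t, Dense {a : A t | ∃ x ∈ Θ, x t = a}
  continuous_norm : ∀ x ∈ Θ, Continuous fun t => ‖x t‖
  mem_of_locally_approx : ∀ x : ∀ t, A t,
    (∀ t, ∀ ε > 0, ∃ x' ∈ Θ, ∀ᶠ s in 𝓝 t, ‖x s - x' s‖ ≤ ε) → x ∈ Θ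

namespace ContinuousField

section Basic

variable {Ω : Type*} [TopologicalSpace Ω] {A : Ω → Type*}
  [∀ t, NonUnitalNormedRing (A t)] [∀ t, NormedSpace ℂ (A t)]

/-- The vector field `x` over `Y ⊆ Ω` is continuous at the point `t₀` of `Y`. -/
def ContAt (U : ContinuousField Ω A) {Y : Set Ω} (x : ∀ t : Y, A t) (t₀ : Y) : Prop :=
  ∀ ε > 0, ∃ x' ∈ U.Θ, ∀ᶠ t : Y in 𝓝 t₀, ‖x t - x' t‖ ≤ ε

theorem ContAt.continuousAt_norm {U : ContinuousField Ω A} {Y : Set Ω} {x : ∀ t : Y, A t} {t₀ : Y}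
    (h : U.ContAt x t₀) : ContinuousAt (fun t => ‖x t‖) t₀ := by
  rw [Metric.continuousAt_iff']
  intro ε hε
  obtain ⟨x', hx', h1⟩ := h (ε / 4) (by positivity)
  have hc : Continuous fun t : Y => ‖x' t‖ :=
    (U.continuous_norm x' hx').comp continuous_subtype_val
  have h2 := Metric.continuousAt_iff'.1 (hc.continuousAt (x := t₀)) (ε / 4) (by positivity)
  have h0 := h1.self_of_nhds
  filter_upwards [h1, h2] with t ht1 ht2
  rw [Real.dist_eq, abs_lt] at *
  have a1 := abs_le.1 ((abs_norm_sub_norm_le (x t) (x' t)).trans ht1)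
  have a2 := abs_le.1 ((abs_norm_sub_norm_le (x t₀) (x' t₀)).trans h0)
  constructor <;> linarith [a1.1, a1.2, a2.1, a2.2, ht2.1, ht2.2]

theorem ContAt.add {U : ContinuousField Ω A} {Y : Set Ω} {x y : ∀ t : Y, A t} {t₀ : Y}
    (hx : U.ContAt x t₀) (hy : U.ContAt y t₀) : U.ContAt (x + y) t₀ := by
  intro ε hε
  obtain ⟨x', hx', h1⟩ := hx (ε / 2) (by positivity)
  obtain ⟨y', hy', h2⟩ := hy (ε / 2) (by positivity)
  refine ⟨x' + y', add_mem hx' hy', ?_⟩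
  filter_upwards [h1, h2] with t ht1 ht2
  calc ‖(x + y) t - (x' + y') t‖ = ‖(x t - x' t) + (y t - y' t)‖ := by
        congr 1; simp only [Pi.add_apply]; abel
    _ ≤ ε := (norm_add_le _ _).trans (by linarith)

theorem ContAt.smul {U : ContinuousField Ω A} {Y : Set Ω} {x : ∀ t : Y, A t} {t₀ : Y} (c : ℂ)
    (hx : U.ContAt x t₀) : U.ContAt (c • x) t₀ := by
  intro ε hε
  obtain ⟨x', hx', h1⟩ := hx (ε / (‖c‖ + 1)) (by positivity)
  refine ⟨c • x', U.Θ.smul_mem c hx', ?_⟩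
  filter_upwards [h1] with t ht1
  calc ‖(c • x) t - (c • x') t‖ = ‖c‖ * ‖x t - x' t‖ := by
        rw [← norm_smul]; congr 1; simp [smul_sub]
    _ ≤ (‖c‖ + 1) * (ε / (‖c‖ + 1)) := by gcongr; linarith
    _ = ε := by field_simp

theorem ContAt.mul {U : ContinuousField Ω A} {Y : Set Ω} {x y : ∀ t : Y, A t} {t₀ : Y}
    (hx : U.ContAt x t₀) (hy : U.ContAt y t₀) : U.ContAt (x * y) t₀ := by
  intro ε hε
  set M : ℝ := ‖x t₀‖ + ‖y t₀‖ + 1 with hM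
  have hMpos : 0 < M := by positivity
  have bx : ∀ᶠ t : Y in 𝓝 t₀, ‖x t‖ < M :=
    hx.continuousAt_norm.eventually_lt continuousAt_const
      (by rw [hM]; linarith [norm_nonneg (y t₀)])
  have bY : ∀ᶠ t : Y in 𝓝 t₀, ‖y t‖ < M :=
    hy.continuousAt_norm.eventually_lt continuousAt_const
      (by rw [hM]; linarith [norm_nonneg (x t₀)])
  set δ : ℝ := min 1 (ε / (2 * M + 1)) with hδ
  have hδpos : 0 < δ := lt_min one_pos (by positivity)
  obtain ⟨x', hx', h1⟩ := hx δ hδpos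
  obtain ⟨y', hy', h2⟩ := hy δ hδpos
  refine ⟨x' * y', mul_mem hx' hy', ?_⟩
  filter_upwards [bx, bY, h1, h2] with t b1 b2 ht1 ht2
  have hx'M : ‖x' t‖ ≤ M + 1 := by
    have := norm_sub_norm_le (x' t) (x t)
    rw [norm_sub_rev] at this
    linarith [min_le_left 1 (ε / (2 * M + 1))]
  calc ‖(x * y) t - (x' * y') t‖ = ‖(x t - x' t) * y t + x' t * (y t - y' t)‖ := by
        congr 1; simp only [Pi.mul_apply, sub_mul, mul_sub]; abel
    _ ≤ ‖x t - x' t‖ * ‖y t‖ + ‖x' t‖ * ‖y t - y' t‖ :=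
        (norm_add_le _ _).trans (add_le_add (norm_mul_le _ _) (norm_mul_le _ _))
    _ ≤ δ * M + (M + 1) * δ := by gcongr
    _ = (2 * M + 1) * δ := by ring
    _ ≤ (2 * M + 1) * (ε / (2 * M + 1)) := by gcongr; exact min_le_right _ _
    _ = ε := by field_simp

/-- The field `U|_Y` induced by `U` on `Y ⊆ Ω`: its continuous vector fields are the vector fields
over `Y` that are continuous at every point of `Y`. -/
def restrict (U : ContinuousField Ω A) (Y : Set Ω) : ContinuousField Y fun t : Y => A t where
  Θ :=
    { carrier := {x | ∀ t₀ : Y, U.ContAt x t₀}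
      add_mem' := fun hx hy t₀ => (hx t₀).add (hy t₀)
      zero_mem' := fun t₀ ε hε => ⟨0, zero_mem _, by simp [hε.le]⟩
      mul_mem' := fun hx hy t₀ => (hx t₀).mul (hy t₀)
      smul_mem' := fun c _ hx t₀ => (hx t₀).smul c }
  dense_eval t := by
    refine (U.dense_eval t).mono ?_
    rintro a ⟨x, hx, rfl⟩
    exact ⟨fun s : Y => x s, fun t₀ ε hε => ⟨x, hx, by simp [hε.le]⟩, rfl⟩
  continuous_norm x hx := continuous_iff_continuousAt.2 fun t => (hx t).continuousAt_norm
  mem_of_locally_approx x hx t₀ ε hε := by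
    obtain ⟨y, hy, h1⟩ := hx t₀ (ε / 2) (by positivity)
    obtain ⟨x', hx', h2⟩ := hy t₀ (ε / 2) (by positivity)
    refine ⟨x', hx', ?_⟩
    filter_upwards [h1, h2] with t ht1 ht2
    exact (norm_sub_le_norm_sub_add_norm_sub _ (y t) _).trans (by linarith)

/-- The constant field over `X` defined by the Banach algebra `B`: its continuous vector fields are
the continuous maps `X → B`. -/
def const (X : Type*) [TopologicalSpace X] (B : Type*) [NonUnitalNormedRing B] [NormedSpace ℂ B] :
    ContinuousField X fun _ => B where
  Θ :=
    { carrier := {x | Continuous x}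
      add_mem' := fun hx hy => Continuous.add hx hy
      zero_mem' := continuous_const
      mul_mem' := fun hx hy => Continuous.mul hx hy
      smul_mem' := fun c _ hx => Continuous.const_smul hx c }
  dense_eval t := by
    have : {a : B | ∃ x : X → B, Continuous x ∧ x t = a} = Set.univ :=
      Set.eq_univ_of_forall fun a => ⟨fun _ => a, continuous_const, rfl⟩
    exact this ▸ dense_univ
  continuous_norm x hx := Continuous.norm hx
  mem_of_locally_approx x hx := by
    refine continuous_iff_continuousAt.2 fun t => Metric.continuousAt_iff'.2 fun ε hε => ?_
    obtain ⟨y, hy, h1⟩ := hx t (ε / 4) (by positivity)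
    have h2 := Metric.continuousAt_iff'.1 (Continuous.continuousAt (x := t) hy) (ε / 4)
      (by positivity)
    have h0 := h1.self_of_nhds
    filter_upwards [h1, h2] with s hs1 hs2
    rw [← dist_eq_norm] at hs1 h0
    rw [dist_comm] at h0
    linarith [dist_triangle4 (x s) (y s) (y t) (x t)]

/-- An isomorphism of continuous fields of Banach algebras over the same space: a family of
isometric isomorphisms of Banach algebras of the fibres which transforms `Θ` into `Θ'`. -/
structure Iso {A' : Ω → Type*} [∀ t, NonUnitalNormedRing (A' t)] [∀ t, NormedSpace ℂ (A' t)]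
    (U : ContinuousField Ω A) (U' : ContinuousField Ω A') where
  φ : ∀ t, A t ≃ₗᵢ[ℂ] A' t
  map_mul : ∀ t (a b : A t), φ t (a * b) = φ t a * φ t b
  mem_iff : ∀ x : ∀ t, A t, x ∈ U.Θ ↔ (fun t => φ t (x t)) ∈ U'.Θ

end Basic

variable {Ω : Type u} [TopologicalSpace Ω] {A : Ω → Type v}
  [∀ t, NonUnitalNormedRing (A t)] [∀ t, NormedSpace ℂ (A t)]

/-- A trivial field: one that is isomorphic to the constant field defined by a Banach algebra. -/
def IsTrivial (U : ContinuousField Ω A) : Prop :=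
  ∃ (B : Type v) (_ : NonUnitalNormedRing B) (_ : NormedSpace ℂ B) (_ : IsScalarTower ℂ B B)
    (_ : SMulCommClass ℂ B B) (_ : CompleteSpace B), Nonempty (U.Iso (const Ω B))

/-- `U` is locally trivial: every point has an open neighbourhood `V` with `U|_V` trivial. -/
def IsLocallyTrivial (U : ContinuousField Ω A) : Prop :=
  ∀ t : Ω, ∃ V : Set Ω, IsOpen V ∧ t ∈ V ∧ (U.restrict V).IsTrivial

section SquareOfTheta

variable [∀ t, IsScalarTower ℂ (A t) (A t)] [∀ t, SMulCommClass ℂ (A t) (A t)]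

/-- `Θ²`, the linear span of the products `x y` with `x, y ∈ Θ`. -/
def thetaSq (U : ContinuousField Ω A) : Submodule ℂ (∀ t, A t) :=
  Submodule.span ℂ {z | ∃ x ∈ U.Θ, ∃ y ∈ U.Θ, z = x * y}

/-- The closure of `Θ²` for uniform convergence on the compact subsets of `Ω`. (It contains the
closure for uniform convergence on `Ω`.) -/
def closureThetaSq (U : ContinuousField Ω A) : Set (∀ t, A t) :=
  {p | ∀ K : Set Ω, IsCompact K → ∀ ε > 0, ∃ q ∈ U.thetaSq, ∀ t ∈ K, ‖p t - q t‖ ≤ ε}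

end SquareOfTheta

/-- Every continuous vector field whose norm vanishes at infinity is bounded. -/
theorem memℓp_of_vanishing (U : ContinuousField Ω A) {x : ∀ t, A t} (hx : x ∈ U.Θ)
    (h0 : Tendsto (fun t => ‖x t‖) (cocompact Ω) (𝓝 0)) : Memℓp x ∞ := by
  refine memℓp_infty ?_
  obtain ⟨K, hK, hKc⟩ := mem_cocompact.1 (h0.eventually (gt_mem_nhds one_pos))
  obtain ⟨M, hM⟩ := (hK.image (U.continuous_norm x hx)).bddAbove
  refine ⟨max M 1, ?_⟩
  rintro _ ⟨t, rfl⟩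
  by_cases ht : t ∈ K
  · exact le_max_of_le_left (hM ⟨t, ht, rfl⟩)
  · exact le_max_of_le_right (le_of_lt (hKc ht))

section SectionAlgebra

variable [∀ t, IsScalarTower ℂ (A t) (A t)] [∀ t, SMulCommClass ℂ (A t) (A t)]

/-- The Banach algebra defined by the continuous field `U`: the continuous vector fields `x` for
which `‖x t‖` vanishes at infinity, with pointwise operations and the norm `sup_t ‖x t‖`. It is
realized inside the algebra `lp A ∞` of all bounded vector fields with the supremum norm; no `x` is
lost, see `memℓp_of_vanishing`. -/
def sectionAlgebra (U : ContinuousField Ω A) : NonUnitalSubalgebra ℂ (lp A ∞) where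
  carrier := {x | (⇑x : ∀ t, A t) ∈ U.Θ ∧ Tendsto (fun t => ‖x t‖) (cocompact Ω) (𝓝 0)}
  add_mem' := by
    rintro x y ⟨hx, hx0⟩ ⟨hy, hy0⟩
    refine ⟨by rw [lp.coeFn_add]; exact add_mem hx hy, ?_⟩
    refine squeeze_zero (fun _ => norm_nonneg _) (fun t => ?_) (by simpa using hx0.add hy0)
    exact norm_add_le _ _
  zero_mem' := ⟨by rw [lp.coeFn_zero]; exact zero_mem _, by simp [tendsto_const_nhds]⟩
  mul_mem' := by
    rintro x y ⟨hx, hx0⟩ ⟨hy, hy0⟩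
    refine ⟨by rw [lp.infty_coeFn_mul]; exact mul_mem hx hy, ?_⟩
    refine squeeze_zero (fun _ => norm_nonneg _) (fun t => ?_) (by simpa using hx0.mul hy0)
    exact norm_mul_le _ _
  smul_mem' := by
    rintro c x ⟨hx, hx0⟩
    refine ⟨by rw [lp.coeFn_smul]; exact U.Θ.smul_mem c hx, ?_⟩
    refine squeeze_zero (fun _ => norm_nonneg _) (fun t => ?_)
      (by simpa using hx0.const_mul ‖c‖)
    exact (norm_smul c (x t)).le

noncomputable instance (U : ContinuousField Ω A) : NormedSpace ℂ U.sectionAlgebra where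
  norm_smul_le c x := norm_smul_le c (x : lp A ∞)

/-- The algebra defined by a continuous field is complete. -/
instance (U : ContinuousField Ω A) [∀ t, CompleteSpace (A t)] :
    CompleteSpace U.sectionAlgebra := by
  have hcl : IsClosed (U.sectionAlgebra : Set (lp A ∞)) := by
    refine isClosed_of_closure_subset fun x hx => ?_
    have happ : ∀ ε > 0, ∃ y ∈ U.sectionAlgebra, ∀ t, ‖x t - y t‖ ≤ ε := by
      intro ε hε
      obtain ⟨y, hy, hxy⟩ := Metric.mem_closure_iff.1 hx ε hε
      refine ⟨y, hy, fun t => ?_⟩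
      rw [dist_eq_norm] at hxy
      exact (lp.norm_apply_le_norm ENNReal.top_ne_zero (x - y) t).trans hxy.le
    refine ⟨U.mem_of_locally_approx _ fun t ε hε => ?_, ?_⟩
    · obtain ⟨y, hy, hxy⟩ := happ ε hε
      exact ⟨y, hy.1, Eventually.of_forall hxy⟩
    · rw [Metric.tendsto_nhds]
      intro ε hε
      obtain ⟨y, hy, hxy⟩ := happ (ε / 2) (by positivity)
      filter_upwards [(Metric.tendsto_nhds.1 hy.2) (ε / 2) (by positivity)] with t ht
      rw [Real.dist_0_eq_abs, abs_norm] at ht ⊢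
      linarith [hxy t, norm_sub_norm_le (x t) (y t)]
  exact hcl.isComplete.completeSpace_coe

end SectionAlgebra

end ContinuousField

/-!
Projectivity provides a bounded linear map `W` from the section algebra `𝒜` to its projective
tensor square, sitting inside the dual of the bounded bilinear forms on `𝒜`; on the closed span of
the products, `W` is a morphism of modules and a right inverse of the product map. If `|β(a, b)|`
is at most `‖a s‖ ‖b t‖`, then `W z β` depends on `z` only through `z s`. It vanishes as `t → ∞`,
uniformly in `s` and `β`, because this holds for elementary tensors.
For `β(a, b) = f (φ_s (a s) φ_t (b t))`, with `φ` a local embedding of the fibres into one algebra,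
it is continuous in `(s, t)`, and on the diagonal it equals `f (φ_s (z s))`. Hence the pairs
`(s, t)` for which some such form is larger than `‖p s‖ / 2` when `z s = p s` form a neighbourhood
of the diagonal whose sections over a compact set stay in a compact set, and such a neighbourhood
forces paracompactness.
-/

section Paracompact

variable {X : Type*} [TopologicalSpace X]

theorem paracompactSpace_of_isLocallyConstant {Y : Type*} {f : X → Y} (hf : IsLocallyConstant f)
    (hp : ∀ y, ParacompactSpace (f ⁻¹' {y})) : ParacompactSpace X := by
  refine ⟨fun α s hs hcov => ?_⟩
  choose v hvo hvc hvf hvs using fun y => precise_refinement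
    (fun a => ((↑) : f ⁻¹' {y} → X) ⁻¹' s a) (fun a => (hs a).preimage continuous_subtype_val)
    (by rw [← Set.preimage_iUnion, hcov, Set.preimage_univ])
  let t (a : α) : Set X := {x | ⟨x, rfl⟩ ∈ v (f x) a}
  have mem_t {a : α} {y : Y} (x : f ⁻¹' {y}) : (x : X) ∈ t a ↔ x ∈ v y a := by
    obtain ⟨x, rfl⟩ := x
    rfl
  have isOpenMap_val (y : Y) : IsOpenMap ((↑) : f ⁻¹' {y} → X) :=
    (hf.isOpen_fiber y).isOpenMap_subtype_val
  refine ⟨α, t, fun a => isOpen_iff_mem_nhds.2 fun x hx => ?_,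
    Set.iUnion_eq_univ_iff.2 fun x => Set.iUnion_eq_univ_iff.1 (hvc (f x)) ⟨x, rfl⟩,
    fun x => ?_, fun a => ⟨a, fun x hx => hvs (f x) a hx⟩⟩
  · filter_upwards [(isOpenMap_val (f x)).image_mem_nhds ((hvo (f x) a).mem_nhds hx)]
    rintro _ ⟨y, hy, rfl⟩
    exact (mem_t y).2 hy
  · obtain ⟨N, hN, hfin⟩ := hvf (f x) ⟨x, rfl⟩
    refine ⟨(↑) '' N, (isOpenMap_val (f x)).image_mem_nhds hN, hfin.subset ?_⟩
    rintro a ⟨_, hy, ⟨y, hyN, rfl⟩⟩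
    exact ⟨y, (mem_t y).1 hy, hyN⟩

theorem isSigmaCompact_setOf_reflTransGen {R : X → X → Prop}
    (hR : ∀ K, IsCompact K → ∃ L, IsCompact L ∧ ∀ x ∈ K, ∀ y, R x y → y ∈ L) {x : X}
    (hx : IsClosed {y | Relation.ReflTransGen R x y}) :
    IsSigmaCompact {y | Relation.ReflTransGen R x y} := by
  choose! L hLc hL using hR
  have isCompact_iterate (n : ℕ) : IsCompact (L^[n] {x}) := by
    induction n with
    | zero => exact isCompact_singleton
    | succ n ih => exact Function.iterate_succ_apply' L n _ ▸ hLc _ ih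
  have exists_mem_iterate {y : X} (hy : Relation.ReflTransGen R x y) : ∃ n : ℕ, y ∈ L^[n] {x} := by
    induction hy with
    | refl => exact ⟨0, rfl⟩
    | tail _ hR ih =>
      obtain ⟨n, hn⟩ := ih
      exact ⟨n + 1, Function.iterate_succ_apply' L n _ ▸ hL _ (isCompact_iterate n) _ hn _ hR⟩
  refine ⟨fun n => L^[n] {x} ∩ {y | Relation.ReflTransGen R x y},
    fun n => (isCompact_iterate n).inter_right hx, ?_⟩
  rw [← Set.iUnion_inter]
  exact Set.inter_eq_right.2 fun y hy => Set.mem_iUnion.2 (exists_mem_iterate hy)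

theorem paracompactSpace_of_mem_nhdsSet_diagonal [T2Space X] [LocallyCompactSpace X]
    {N : Set (X × X)} (hN : N ∈ 𝓝ˢ (Set.diagonal X))
    (hK : ∀ K, IsCompact K → ∃ L, IsCompact L ∧ ∀ x ∈ K, ∀ y, (x, y) ∈ N → y ∈ L) :
    ParacompactSpace X := by
  let R (x y : X) : Prop := (x, y) ∈ N ∧ (y, x) ∈ N
  have hR_nhds (x : X) : ∀ᶠ y in 𝓝 x, R x y := by
    have h : N ∈ 𝓝 (x, x) := mem_nhdsSet_iff_forall.1 hN (x, x) rfl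
    exact ((Continuous.prodMk_right x).continuousAt.eventually h).and
      ((Continuous.prodMk_left x).continuousAt.eventually h)
  have hR_symm : ∀ {x y}, Relation.ReflTransGen R x y → Relation.ReflTransGen R y x :=
    fun h => (@Relation.ReflTransGen.stdSymm _ R ⟨fun _ _ h => h.symm⟩).symm _ _ h
  let S : DiscreteQuotient X :=
    { r := Relation.ReflTransGen R
      iseqv := ⟨fun _ => .refl, hR_symm, .trans⟩
      isOpen_setOfPred_rel := fun x => isOpen_iff_mem_nhds.2 fun y hy =>
        (hR_nhds y).mono fun _ hz => .tail hy hz }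
  refine paracompactSpace_of_isLocallyConstant S.proj_isLocallyConstant
    (S.proj_surjective.forall.2 fun x => ?_)
  have hσ : IsSigmaCompact (S.proj ⁻¹' {S.proj x}) := by
    have hcl := S.isClosed_preimage {S.proj x}
    rw [S.fiber_eq] at hcl ⊢
    refine isSigmaCompact_setOf_reflTransGen (fun K hKc => ?_) hcl
    obtain ⟨L, hL, hKL⟩ := hK K hKc
    exact ⟨L, hL, fun x hx y hxy => hKL x hx y hxy.1⟩
  have := isSigmaCompact_iff_sigmaCompactSpace.1 hσ
  have := (S.isOpen_preimage {S.proj x}).locallyCompactSpace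
  infer_instance

end Paracompact

section ClosedSpan

variable {𝕜 E F G H : Type*} [NontriviallyNormedField 𝕜] [NormedAddCommGroup E]
  [NormedSpace 𝕜 E] [NormedAddCommGroup F] [NormedSpace 𝕜 F] [NormedAddCommGroup G]
  [NormedSpace 𝕜 G] [NormedAddCommGroup H] [NormedSpace 𝕜 H] {τ : E →L[𝕜] F →L[𝕜] G}

/-- The closed linear span of the values of a bounded bilinear map. -/
def closedSpan₂ (τ : E →L[𝕜] F →L[𝕜] G) : Submodule 𝕜 G :=
  (Submodule.span 𝕜 (Set.range fun q : E × F => τ q.1 q.2)).topologicalClosure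

theorem isClosed_closedSpan₂ : IsClosed (closedSpan₂ τ : Set G) :=
  Submodule.isClosed_topologicalClosure _

theorem apply_mem_closedSpan₂ (a : E) (b : F) : τ a b ∈ closedSpan₂ τ :=
  Submodule.le_topologicalClosure _ (Submodule.subset_span ⟨(a, b), rfl⟩)

theorem closedSpan₂_le {S : Submodule 𝕜 G} (hS : IsClosed (S : Set G)) (h : ∀ a b, τ a b ∈ S) :
    closedSpan₂ τ ≤ S :=
  Submodule.topologicalClosure_minimal _
    (Submodule.span_le.2 (Set.range_subset_iff.2 fun q => h q.1 q.2)) hS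

theorem map_mem_closedSpan₂ {T : G →L[𝕜] G} (hT : ∀ a b, T (τ a b) ∈ closedSpan₂ τ) {u : G}
    (hu : u ∈ closedSpan₂ τ) : T u ∈ closedSpan₂ τ :=
  closedSpan₂_le (S := (closedSpan₂ τ).comap T.toLinearMap)
    (isClosed_closedSpan₂.preimage T.continuous) hT hu

theorem eqOn_closedSpan₂ {T T' : G →L[𝕜] H} (h : ∀ a b, T (τ a b) = T' (τ a b)) :
    Set.EqOn T T' (closedSpan₂ τ) := fun _ hu =>
  sub_eq_zero.1 (closedSpan₂_le (S := (T - T').toLinearMap.ker) (T - T').isClosed_ker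
    (fun a b => sub_eq_zero.2 (h a b)) hu)

end ClosedSpan

section BilinearForms

set_option maxSynthPendingDepth 3

variable {E : Type u} [NormedAddCommGroup E] [NormedSpace ℂ E]

/-- The dual of the space of bounded bilinear forms on `E`. It contains the projective tensor
product `E ⊗̂ E` isometrically, as `closedSpan₂ elemTensor`. -/
abbrev BilinFormDual (E : Type u) [NormedAddCommGroup E] [NormedSpace ℂ E] : Type u :=
  (E →L[ℂ] E →L[ℂ] ℂ) →L[ℂ] ℂ

/-- The elementary tensor `a ⊗ b`, as the functional `β ↦ β a b` on bounded bilinear forms. -/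
noncomputable def elemTensor : E →L[ℂ] E →L[ℂ] BilinFormDual E :=
  ((ContinuousLinearMap.compL ℂ (E →L[ℂ] E →L[ℂ] ℂ) (E →L[ℂ] ℂ) ℂ).bilinearComp
    (ContinuousLinearMap.apply ℂ ℂ) (ContinuousLinearMap.apply ℂ (E →L[ℂ] ℂ))).flip

/-- The action `x · u` of `x` on a functional `u` which extends `x · (a ⊗ b) = μ x a ⊗ b`. -/
noncomputable def bilinFormDualAct (μ : E →L[ℂ] E →L[ℂ] E) :
    E →L[ℂ] BilinFormDual E →L[ℂ] BilinFormDual E :=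
  (ContinuousLinearMap.compL ℂ (E →L[ℂ] E →L[ℂ] ℂ) (E →L[ℂ] E →L[ℂ] ℂ) ℂ).flip.comp
    ((ContinuousLinearMap.compL ℂ E E (E →L[ℂ] ℂ)).flip.comp μ)

theorem bilinFormDualAct_apply (μ : E →L[ℂ] E →L[ℂ] E) (x : E) (u : BilinFormDual E)
    (β : E →L[ℂ] E →L[ℂ] ℂ) : bilinFormDualAct μ x u β = u (β.comp (μ x)) := rfl

theorem bilinFormDualAct_elemTensor (μ : E →L[ℂ] E →L[ℂ] E) (x a b : E) :
    bilinFormDualAct μ x (elemTensor a b) = elemTensor (μ x a) b := rfl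

theorem bilinFormDualAct_assoc {μ : E →L[ℂ] E →L[ℂ] E} (hμ : ∀ a b c, μ (μ a b) c = μ a (μ b c))
    (x y : E) (u : BilinFormDual E) :
    bilinFormDualAct μ (μ x y) u = bilinFormDualAct μ x (bilinFormDualAct μ y u) := by
  ext β
  have h : β.comp (μ (μ x y)) = (β.comp (μ x)).comp (μ y) :=
    ContinuousLinearMap.ext fun c => congrArg β (hμ x y c)
  simp only [bilinFormDualAct_apply, h]

/-- The form `(a, b) ↦ f (μ a b)`. -/
noncomputable def formOfProduct (μ : E →L[ℂ] E →L[ℂ] E) (f : E →L[ℂ] ℂ) : E →L[ℂ] E →L[ℂ] ℂ :=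
  (ContinuousLinearMap.compL ℂ E E ℂ f).comp μ

theorem formOfProduct_comp {μ : E →L[ℂ] E →L[ℂ] E} (hμ : ∀ a b c, μ (μ a b) c = μ a (μ b c))
    (f : E →L[ℂ] ℂ) (x : E) : (formOfProduct μ f).comp (μ x) = formOfProduct μ (f.comp (μ x)) :=
  ContinuousLinearMap.ext fun a => ContinuousLinearMap.ext fun b => congrArg f (hμ x a b)

theorem tendsto_apply_of_mem_closedSpan₂ {u : BilinFormDual E} (hu : u ∈ closedSpan₂ elemTensor)
    {X : Type*} {l : Filter X} {β : X → E →L[ℂ] E →L[ℂ] ℂ} {β₀ : E →L[ℂ] E →L[ℂ] ℂ}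
    (hβ : ∀ x, ‖β x‖ ≤ 1) (h : ∀ a b, Tendsto (fun x => β x a b) l (𝓝 (β₀ a b))) :
    Tendsto (fun x => u (β x)) l (𝓝 (u β₀)) := by
  let S : Submodule ℂ (BilinFormDual E) :=
    { carrier := {u | Tendsto (fun x => u (β x)) l (𝓝 (u β₀))}
      add_mem' := fun hu hv => hu.add hv
      zero_mem' := tendsto_const_nhds
      smul_mem' := fun c _ hu => hu.const_smul c }
  have equicontinuous : Equicontinuous fun x (u : BilinFormDual E) => u (β x) :=
    (LipschitzWith.uniformEquicontinuous _ 1 fun x => .of_dist_le_mul fun u v => by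
      rw [NNReal.coe_one, one_mul, dist_eq_norm, dist_eq_norm, ← sub_apply]
      exact (u - v).unit_le_opNorm _ (hβ x)).equicontinuous
  exact closedSpan₂_le (S := S)
    (equicontinuous.isClosed_setOfPred_tendsto (ContinuousLinearMap.apply ℂ ℂ β₀).continuous) h hu

end BilinearForms

section Projective

variable {E : Type u} [NormedAddCommGroup E] [NormedSpace ℂ E]

/-- Projectivity of `E` as a Banach module over itself, for the bounded associative product `μ`. -/
def IsProjectiveFor (μ : E →L[ℂ] E →L[ℂ] E) : Prop :=
  ∀ (Y : Type u) [NormedAddCommGroup Y] [NormedSpace ℂ Y] [CompleteSpace Y]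
    (m : E →L[ℂ] Y →L[ℂ] Y) (φ : Y →L[ℂ] E),
    (∀ a b y, m (μ a b) y = m a (m b y)) → (∀ a y, φ (m a y) = μ a (φ y)) →
    (∃ σ : E →L[ℂ] Y, φ.comp σ = ContinuousLinearMap.id ℂ E) →
    ∃ ψ : E →L[ℂ] Y, (∀ a x, ψ (μ a x) = m a (ψ x)) ∧ φ.comp ψ = ContinuousLinearMap.id ℂ E

/-- The restriction of a bounded bilinear action to an invariant subspace. -/
noncomputable def restrictAct {Y : Type*} [NormedAddCommGroup Y] [NormedSpace ℂ Y]
    (m : E →L[ℂ] Y →L[ℂ] Y) (S : Submodule ℂ Y) (h : ∀ x, ∀ y ∈ S, m x y ∈ S) :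
    E →L[ℂ] S →L[ℂ] S :=
  LinearMap.mkContinuous₂
    (LinearMap.mk₂ ℂ (fun x (y : S) => (⟨m x y, h x y y.2⟩ : S))
      (fun _ _ _ => by ext; simp) (fun _ _ _ => by ext; simp)
      (fun _ _ _ => by ext; simp) (fun _ _ _ => by ext; simp))
    ‖m‖ (fun x y => m.le_opNorm₂ x y)

set_option maxSynthPendingDepth 3

/-- The action `x · (b, u, e) = (0, x ⊗ b + x · u, μ x e)` of `E` on `freeCover μ`, on the ambient
space. -/
noncomputable def freeCoverAct (μ : E →L[ℂ] E →L[ℂ] E) :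
    E →L[ℂ] (E × BilinFormDual E × E) →L[ℂ] (E × BilinFormDual E × E) :=
  (ContinuousLinearMap.compL ℂ _ _ _ (.inr ℂ E (BilinFormDual E × E))).comp
    ((ContinuousLinearMap.compL ℂ _ _ _ (.inl ℂ (BilinFormDual E) E)).comp
      (elemTensor.bilinearComp (.id ℂ E) (.fst ℂ _ _) +
        (bilinFormDualAct μ).bilinearComp (.id ℂ E)
          ((ContinuousLinearMap.fst ℂ _ _).comp (.snd ℂ _ _))) +
     (ContinuousLinearMap.compL ℂ _ _ _ (.inr ℂ (BilinFormDual E) E)).comp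
      (μ.bilinearComp (.id ℂ E) ((ContinuousLinearMap.snd ℂ _ _).comp (.snd ℂ _ _))))

theorem freeCoverAct_apply (μ : E →L[ℂ] E →L[ℂ] E) (x : E) (w : E × BilinFormDual E × E) :
    freeCoverAct μ x w = (0, elemTensor x w.1 + bilinFormDualAct μ x w.2.1, μ x w.2.2) := by
  simp [freeCoverAct]

/-- The free Banach module `E₊ ⊗̂ E` for the product `μ`, where `E₊` is the unitization: `(b, u, e)`
stands for `1 ⊗ b + u`, and `e` is its product, which is determined by `b` and `u` since
`f (e - b) = u (f ∘ μ)` for all functionals `f`. -/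
def freeCover (μ : E →L[ℂ] E →L[ℂ] E) : Submodule ℂ (E × BilinFormDual E × E) where
  carrier := {w | w.2.1 ∈ closedSpan₂ elemTensor ∧
    ∀ f : E →L[ℂ] ℂ, w.2.1 (formOfProduct μ f) = f (w.2.2 - w.1)}
  zero_mem' := ⟨zero_mem _, fun f => by simp⟩
  add_mem' := fun {w w'} h h' => ⟨add_mem h.1 h'.1, fun f => by
    simp only [Prod.snd_add, Prod.fst_add, add_sub_add_comm, map_add, add_apply, h.2, h'.2]⟩
  smul_mem' := fun c w h => ⟨Submodule.smul_mem _ c h.1, fun f => by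
    simp only [Prod.smul_snd, Prod.smul_fst, ← smul_sub, map_smul, smul_apply, h.2]⟩

variable {μ : E →L[ℂ] E →L[ℂ] E}

theorem isClosed_freeCover : IsClosed (freeCover μ : Set (E × BilinFormDual E × E)) := by
  have h : IsClosed {w : E × BilinFormDual E × E |
      ∀ f : E →L[ℂ] ℂ, w.2.1 (formOfProduct μ f) = f (w.2.2 - w.1)} := by
    simp only [Set.ofPred_forall]
    exact isClosed_iInter fun f => isClosed_eq (by fun_prop) (by fun_prop)
  exact (isClosed_closedSpan₂.preimage (continuous_fst.comp continuous_snd)).inter h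

theorem freeCoverAct_mem (hμ : ∀ a b c, μ (μ a b) c = μ a (μ b c)) (x : E)
    {w : E × BilinFormDual E × E} (hw : w ∈ freeCover μ) : freeCoverAct μ x w ∈ freeCover μ := by
  rw [freeCoverAct_apply]
  refine ⟨add_mem (apply_mem_closedSpan₂ _ _) (map_mem_closedSpan₂
    (fun a b => apply_mem_closedSpan₂ (μ x a) b) hw.1), fun f => ?_⟩
  calc (elemTensor x w.1 + bilinFormDualAct μ x w.2.1) (formOfProduct μ f)
      = f (μ x w.1) + w.2.1 ((formOfProduct μ f).comp (μ x)) := rfl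
    _ = f (μ x w.1) + f (μ x (w.2.2 - w.1)) := by rw [formOfProduct_comp hμ, hw.2]; rfl
    _ = f (μ x w.2.2 - 0) := by rw [← map_add, ← map_add, add_sub_cancel, sub_zero]

/-- `W` splits the product `μ` on the products: it takes values in the projective tensor product
`E ⊗̂ E`, it is a right inverse of the product map on them, and `x ↦ W (μ x y)` is given by the
action of `x` on an element of the free module `E₊ ⊗̂ E`. -/
structure IsSplitting (μ : E →L[ℂ] E →L[ℂ] E) (W : E →L[ℂ] BilinFormDual E) : Prop where
  mem_closedSpan₂ : ∀ z, W z ∈ closedSpan₂ elemTensor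
  apply_formOfProduct : ∀ x y f, W (μ x y) (formOfProduct μ f) = f (μ x y)
  exists_apply_eq : ∀ y, ∃ b u, ∀ x, W (μ x y) = elemTensor x b + bilinFormDualAct μ x u

theorem IsProjectiveFor.exists_isSplitting [CompleteSpace E] (hproj : IsProjectiveFor μ)
    (hμ : ∀ a b c, μ (μ a b) c = μ a (μ b c)) : ∃ W, IsSplitting μ W := by
  have : CompleteSpace (freeCover μ) := isClosed_freeCover.completeSpace_coe
  let φ : freeCover μ →L[ℂ] E :=
    ((ContinuousLinearMap.snd ℂ _ _).comp (.snd ℂ _ _)).comp (freeCover μ).subtypeL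
  let σ : E →L[ℂ] freeCover μ :=
    ((ContinuousLinearMap.id ℂ E).prod (.prod 0 (.id ℂ E))).codRestrict _
      fun e => ⟨zero_mem _, fun f => by simp⟩
  obtain ⟨ψ, hψ, hφψ⟩ := hproj (freeCover μ)
    (restrictAct (freeCoverAct μ) _ fun x _ => freeCoverAct_mem hμ x) φ
    (fun a b w => Subtype.ext <| by
      change freeCoverAct μ (μ a b) w = freeCoverAct μ a (freeCoverAct μ b w)
      simp only [freeCoverAct_apply, hμ, bilinFormDualAct_assoc hμ, map_add, map_zero, zero_add,
        bilinFormDualAct_elemTensor])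
    (fun a w => by
      change (freeCoverAct μ a w).2.2 = _
      rw [freeCoverAct_apply]; rfl)
    ⟨σ, rfl⟩
  have hψ' (x y : E) : (ψ (μ x y) : E × BilinFormDual E × E) =
      (0, elemTensor x (ψ y).1.1 + bilinFormDualAct μ x (ψ y).1.2.1, μ x (ψ y).1.2.2) :=
    (congrArg Subtype.val (hψ x y)).trans (freeCoverAct_apply μ x _)
  refine ⟨((ContinuousLinearMap.fst ℂ _ _).comp (.snd ℂ _ _)).comp ((freeCover μ).subtypeL.comp ψ),
    fun z => (ψ z).2.1, fun x y f => ?_, fun y => ⟨(ψ y).1.1, (ψ y).1.2.1, fun x => ?_⟩⟩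
  · have h1 : (ψ (μ x y)).1.1 = 0 := congrArg Prod.fst (hψ' x y)
    have h2 : (ψ (μ x y)).1.2.2 = μ x y := DFunLike.congr_fun hφψ (μ x y)
    exact ((ψ (μ x y)).2.2 f).trans (by rw [h1, h2, sub_zero])
  · exact congrArg (fun w => w.2.1) (hψ' x y)

namespace IsSplitting

variable {W : E →L[ℂ] BilinFormDual E}

theorem apply_eq (hW : IsSplitting μ W) (f : E →L[ℂ] ℂ) {z : E} (hz : z ∈ closedSpan₂ μ) :
    W z (formOfProduct μ f) = f z :=
  eqOn_closedSpan₂ (T := (ContinuousLinearMap.apply ℂ ℂ (formOfProduct μ f)).comp W) (T' := f)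
    (fun x y => hW.apply_formOfProduct x y f) hz

theorem apply_map (hW : IsSplitting μ W) {T : E →L[ℂ] E} (hT : ∀ x y, T (μ x y) = μ (T x) y)
    {k : ℂ} {β : E →L[ℂ] E →L[ℂ] ℂ} (hβ : ∀ x, β (T x) = k • β x) {z : E}
    (hz : z ∈ closedSpan₂ μ) : W (T z) β = k * W z β := by
  let L : E →L[ℂ] ℂ := (ContinuousLinearMap.apply ℂ ℂ β).comp W
  refine eqOn_closedSpan₂ (T := L.comp T) (T' := k • L) (fun x y => ?_) hz
  obtain ⟨b, u, h⟩ := hW.exists_apply_eq y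
  have hcomp : β.comp (μ (T x)) = k • β.comp (μ x) :=
    ContinuousLinearMap.ext fun a => (congrArg β (hT x a)).symm.trans (hβ (μ x a))
  calc W (T (μ x y)) β = β (T x) b + u (β.comp (μ (T x))) := by rw [hT, h]; rfl
    _ = k • (β x b + u (β.comp (μ x))) := by rw [hβ, hcomp, map_smul, smul_add]; rfl
    _ = k • W (μ x y) β := by rw [h]; rfl

end IsSplitting

end Projective

/-- The two sides on which a Banach algebra may act on itself. -/
inductive Side
  | left
  | right

namespace Side

variable {R : Type*} [NonUnitalNormedRing R] [NormedSpace ℂ R] [IsScalarTower ℂ R R]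
  [SMulCommClass ℂ R R]

/-- The action of `R` on itself from the given side, `x ↦ (y ↦ x * y)` or `x ↦ (y ↦ y * x)`, so
that a left or right module over `R` is a left module for `σ.mul R`. -/
noncomputable def mul (R : Type*) [NonUnitalNormedRing R] [NormedSpace ℂ R] [IsScalarTower ℂ R R]
    [SMulCommClass ℂ R R] : Side → R →L[ℂ] R →L[ℂ] R
  | left => ContinuousLinearMap.mul ℂ R
  | right => (ContinuousLinearMap.mul ℂ R).flip

theorem mul_assoc (σ : Side) (a b c : R) :
    σ.mul R (σ.mul R a b) c = σ.mul R a (σ.mul R b c) := by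
  cases σ
  · exact _root_.mul_assoc a b c
  · exact (_root_.mul_assoc c b a).symm

theorem norm_mul_le (σ : Side) (a b : R) : ‖σ.mul R a b‖ ≤ ‖a‖ * ‖b‖ := by
  cases σ
  · exact _root_.norm_mul_le a b
  · exact (_root_.norm_mul_le b a).trans_eq (mul_comm _ _)

theorem map_mul (σ : Side) {S : Type*} [NonUnitalNormedRing S] [NormedSpace ℂ S]
    [IsScalarTower ℂ S S] [SMulCommClass ℂ S S] {φ : R → S} (hφ : ∀ a b, φ (a * b) = φ a * φ b)
    (a b : R) : φ (σ.mul R a b) = σ.mul S (φ a) (φ b) := by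
  cases σ
  · exact hφ a b
  · exact hφ b a

theorem exists_isProjectiveFor_mul {R : Type u} [NonUnitalNormedRing R] [NormedSpace ℂ R]
    [IsScalarTower ℂ R R] [SMulCommClass ℂ R R] [CompleteSpace R]
    (h : IsLeftProjectiveBanachAlgebra R ∨ IsRightProjectiveBanachAlgebra R) :
    ∃ σ : Side, IsProjectiveFor (σ.mul R) := by
  rcases h with h | h
  · exact ⟨left, fun Y _ _ _ m φ hm hφ hφσ => h Y ⟨m, hm⟩ φ hφ hφσ⟩
  · exact ⟨right, fun Y _ _ _ m φ hm hφ hφσ => h Y ⟨m, fun a b y => hm b a y⟩ φ hφ hφσ⟩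

end Side

namespace ContinuousField

open scoped CompactlySupported

theorem exists_bump {X : Type*} [TopologicalSpace X] [T2Space X] [LocallyCompactSpace X]
    {K V : Set X} (hK : IsCompact K) (hV : IsOpen V) (hKV : K ⊆ V) :
    ∃ h : C_c(X, ℂ), (∀ t ∈ K, h t = 1) ∧ (∀ t ∉ V, h t = 0) ∧ ∀ t, ‖h t‖ ≤ 1 := by
  obtain ⟨f, hf1, hfc, hfV, hfI⟩ := exists_continuousMap_one_of_isCompact_subset_isOpen hK hV hKV
  have hf : HasCompactSupport f := hfc
  refine ⟨⟨⟨fun t => (f t : ℂ), by fun_prop⟩, hf.comp_left Complex.ofReal_zero⟩,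
    fun t ht => ?_, fun t ht => ?_, fun t => ?_⟩
  · change (f t : ℂ) = 1
    rw [hf1 ht, Pi.one_apply, Complex.ofReal_one]
  · change (f t : ℂ) = 0
    rw [image_eq_zero_of_notMem_tsupport fun h => ht (hfV h), Complex.ofReal_zero]
  · change ‖(f t : ℂ)‖ ≤ 1
    rw [Complex.norm_of_nonneg (hfI t).1]
    exact (hfI t).2

variable {Ω : Type u} [TopologicalSpace Ω] {A : Ω → Type v}
  [∀ t, NonUnitalNormedRing (A t)] [∀ t, NormedSpace ℂ (A t)]

/-- A locally subtrivial field: near every point, the fibres embed isometrically into one normed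
algebra in such a way that the continuous vector fields become continuous maps. -/
def IsLocallySubtrivial (U : ContinuousField Ω A) : Prop :=
  ∀ t₀ : Ω, ∃ V : Set Ω, IsOpen V ∧ t₀ ∈ V ∧
    ∃ (B : Type v) (_ : NonUnitalNormedRing B) (_ : NormedSpace ℂ B) (_ : IsScalarTower ℂ B B)
      (_ : SMulCommClass ℂ B B) (φ : ∀ t : V, A t →ₗᵢ[ℂ] B),
      (∀ t a b, φ t (a * b) = φ t a * φ t b) ∧ ∀ x ∈ U.Θ, Continuous fun t : V => φ t (x t)

theorem IsLocallyTrivial.isLocallySubtrivial {U : ContinuousField Ω A} (hU : U.IsLocallyTrivial) :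
    U.IsLocallySubtrivial := by
  intro t₀
  obtain ⟨V, hV, ht₀, B, _, _, _, _, _, ⟨i⟩⟩ := hU t₀
  refine ⟨V, hV, ht₀, B, _, _, ‹_›, ‹_›, fun t => (i.φ t).toLinearIsometry, i.map_mul, ?_⟩
  exact fun x hx => (i.mem_iff fun t => x t).1 fun _ ε hε => ⟨x, hx, by simp [hε.le]⟩

theorem smul_mem_Θ (U : ContinuousField Ω A) {g : Ω → ℂ} (hg : Continuous g) {x : ∀ t, A t}
    (hx : x ∈ U.Θ) : (fun t => g t • x t) ∈ U.Θ := by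
  refine U.mem_of_locally_approx _ fun t ε hε => ⟨g t • x, U.Θ.smul_mem _ hx, ?_⟩
  have hc : Continuous fun s => ‖g s - g t‖ * ‖x s‖ :=
    (hg.sub continuous_const).norm.mul (U.continuous_norm x hx)
  filter_upwards [hc.continuousAt.eventually_lt (continuousAt_const (y := ε)) (by simpa using hε)]
    with s hs
  rw [Pi.smul_apply, ← sub_smul, norm_smul]
  exact hs.le

/-- The evaluation homomorphism `x ↦ x t` of the section algebra. -/
noncomputable def eval (U : ContinuousField Ω A) (t : Ω) : U.sectionAlgebra →L[ℂ] A t :=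
  LinearMap.mkContinuous
    { toFun := fun x => (x : lp A ∞) t
      map_add' := fun _ _ => rfl
      map_smul' := fun _ _ => rfl } 1 fun x => by
    rw [one_mul]; exact lp.norm_apply_le_norm ENNReal.top_ne_zero (x : lp A ∞) t

variable {U : ContinuousField Ω A}

theorem norm_eval_le (t : Ω) (x : U.sectionAlgebra) : ‖U.eval t x‖ ≤ ‖x‖ :=
  lp.norm_apply_le_norm ENNReal.top_ne_zero (x : lp A ∞) t

theorem norm_le_of_eval_le {x : U.sectionAlgebra} {C : ℝ} (hC : 0 ≤ C)
    (h : ∀ t, ‖U.eval t x‖ ≤ C) : ‖x‖ ≤ C :=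
  lp.norm_le_of_forall_le hC h

theorem eval_mem_Θ (x : U.sectionAlgebra) : (fun t => U.eval t x) ∈ U.Θ := x.2.1

theorem tendsto_norm_eval (x : U.sectionAlgebra) :
    Tendsto (fun t => ‖U.eval t x‖) (cocompact Ω) (𝓝 0) := x.2.2

theorem ext_eval {x y : U.sectionAlgebra} (h : ∀ t, U.eval t x = U.eval t y) : x = y :=
  Subtype.ext (lp.ext (funext h))

section FiberForms

set_option maxSynthPendingDepth 3

/-- The bilinear forms on the section algebra whose two arguments are seen only at `s` and at `t`:
those with `‖β a b‖ ≤ ‖a s‖ ‖b t‖`. -/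
def fiberForms (U : ContinuousField Ω A) (s t : Ω) :
    Set (U.sectionAlgebra →L[ℂ] U.sectionAlgebra →L[ℂ] ℂ) :=
  {β | ∀ a b, ‖β a b‖ ≤ ‖U.eval s a‖ * ‖U.eval t b‖}

variable {s t : Ω} {β : U.sectionAlgebra →L[ℂ] U.sectionAlgebra →L[ℂ] ℂ}

theorem norm_le_one_of_mem_fiberForms (hβ : β ∈ U.fiberForms s t) : ‖β‖ ≤ 1 :=
  ContinuousLinearMap.opNorm_le_bound₂ _ zero_le_one fun a b => by
    rw [one_mul]
    exact (hβ a b).trans (by gcongr <;> exact norm_eval_le _ _)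

theorem eq_of_mem_fiberForms (hβ : β ∈ U.fiberForms s t) {x y : U.sectionAlgebra}
    (h : U.eval s x = U.eval s y) : β x = β y := by
  refine sub_eq_zero.1 (ContinuousLinearMap.ext fun b => norm_le_zero_iff.1 ?_)
  have hxy : U.eval s (x - y) = 0 := by rw [map_sub, h, sub_self]
  simpa only [map_sub, hxy, norm_zero, zero_mul] using hβ (x - y) b

theorem eventually_forall_fiberForms_norm_lt {u : BilinFormDual U.sectionAlgebra}
    (hu : u ∈ closedSpan₂ elemTensor) {ε : ℝ} (hε : 0 < ε) :
    ∀ᶠ t in cocompact Ω, ∀ s, ∀ β ∈ U.fiberForms s t, ‖u β‖ < ε := by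
  let X := {q : Ω × Ω × (U.sectionAlgebra →L[ℂ] U.sectionAlgebra →L[ℂ] ℂ) //
    q.2.2 ∈ U.fiberForms q.1 q.2.1}
  let l : Filter X := comap (fun q => q.1.2.1) (cocompact Ω)
  have hl (a b : U.sectionAlgebra) : Tendsto (fun q : X => q.1.2.2 a b) l (𝓝 0) := by
    have hb : Tendsto (fun q : X => ‖a‖ * ‖U.eval q.1.2.1 b‖) l (𝓝 0) := by
      simpa only [mul_zero, Function.comp_apply] using
        ((tendsto_norm_eval b).comp tendsto_comap).const_mul ‖a‖
    exact squeeze_zero_norm (fun q => (q.2 a b).trans (by gcongr; exact norm_eval_le _ _)) hb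
  have hlim := tendsto_apply_of_mem_closedSpan₂ hu (β₀ := 0)
    (fun q : X => norm_le_one_of_mem_fiberForms q.2) hl
  rw [map_zero, tendsto_zero_iff_norm_tendsto_zero] at hlim
  filter_upwards [eventually_comap.1 (hlim.eventually_lt_const hε)] with t ht s β hβ
  exact ht ⟨(s, t, β), hβ⟩ rfl

/-- The bilinear form `(a, b) ↦ f (φ (a s) ψ (b t))`, with the product of `B` taken on the side
`σ`. -/
noncomputable def productForm (U : ContinuousField Ω A) (σ : Side) {B : Type*}
    [NonUnitalNormedRing B] [NormedSpace ℂ B] [IsScalarTower ℂ B B] [SMulCommClass ℂ B B]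
    (f : B →L[ℂ] ℂ) {s t : Ω} (φ : A s →L[ℂ] B) (ψ : A t →L[ℂ] B) :
    U.sectionAlgebra →L[ℂ] U.sectionAlgebra →L[ℂ] ℂ :=
  (formOfProduct (σ.mul B) f).bilinearComp (φ.comp (U.eval s)) (ψ.comp (U.eval t))

theorem productForm_mem_fiberForms (σ : Side) {B : Type*} [NonUnitalNormedRing B] [NormedSpace ℂ B]
    [IsScalarTower ℂ B B] [SMulCommClass ℂ B B] {f : B →L[ℂ] ℂ} (hf : ‖f‖ ≤ 1) {s t : Ω}
    (φ : A s →ₗᵢ[ℂ] B) (ψ : A t →ₗᵢ[ℂ] B) :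
    U.productForm σ f φ.toContinuousLinearMap ψ.toContinuousLinearMap ∈ U.fiberForms s t := by
  intro a b
  calc ‖f (σ.mul B (φ (U.eval s a)) (ψ (U.eval t b)))‖
      ≤ ‖σ.mul B (φ (U.eval s a)) (ψ (U.eval t b))‖ :=
        (f.le_of_opNorm_le hf _).trans_eq (one_mul _)
    _ ≤ ‖φ (U.eval s a)‖ * ‖ψ (U.eval t b)‖ := σ.norm_mul_le _ _
    _ = ‖U.eval s a‖ * ‖U.eval t b‖ := by rw [φ.norm_map, ψ.norm_map]

end FiberForms

section Cutoff

variable [T2Space Ω]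

theorem tendsto_norm_smul_cocompact (h : C_c(Ω, ℂ)) (x : ∀ t, A t) :
    Tendsto (fun t => ‖h t • x t‖) (cocompact Ω) (𝓝 0) := by
  have h0 := hasCompactSupport_iff_eventuallyEq.1 h.hasCompactSupport
  rw [coclosedCompact_eq_cocompact] at h0
  refine tendsto_const_nhds.congr' (h0.mono fun t ht => ?_)
  dsimp only
  rw [ht, Pi.zero_apply, zero_smul, norm_zero]

/-- The section `h x` of compact support, for a continuous vector field `x`. -/
noncomputable def cutoff (U : ContinuousField Ω A) (h : C_c(Ω, ℂ)) : U.Θ →ₗ[ℂ] U.sectionAlgebra :=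
  have mem_Θ (x : U.Θ) : (fun t => h t • x.1 t) ∈ U.Θ := U.smul_mem_Θ h.continuous x.2
  have tendsto (x : U.Θ) := tendsto_norm_smul_cocompact h x.1
  { toFun := fun x => ⟨⟨_, U.memℓp_of_vanishing (mem_Θ x) (tendsto x)⟩, mem_Θ x, tendsto x⟩
    map_add' := fun x y => ext_eval fun t => smul_add (h t) (x.1 t) (y.1 t)
    map_smul' := fun k x => ext_eval fun t => smul_comm (h t) k (x.1 t) }

theorem eval_cutoff (h : C_c(Ω, ℂ)) (x : U.Θ) (t : Ω) : U.eval t (U.cutoff h x) = h t • x.1 t := rfl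

theorem norm_cutoff_le {h : C_c(Ω, ℂ)} (hh : ∀ t, ‖h t‖ ≤ 1) {x : U.Θ} {C : ℝ} (hC : 0 ≤ C)
    (hx : ∀ t, h t ≠ 0 → ‖x.1 t‖ ≤ C) : ‖U.cutoff h x‖ ≤ C := by
  refine norm_le_of_eval_le hC fun t => ?_
  rw [eval_cutoff, norm_smul]
  rcases eq_or_ne (h t) 0 with h0 | h0
  · rwa [h0, norm_zero, zero_mul]
  · exact (mul_le_of_le_one_left (norm_nonneg _) (hh t)).trans (hx t h0)

/-- Multiplication by `h`, as a bounded operator on the section algebra. -/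
noncomputable def cutoffL (U : ContinuousField Ω A) (h : C_c(Ω, ℂ)) :
    U.sectionAlgebra →L[ℂ] U.sectionAlgebra :=
  LinearMap.mkContinuousOfExistsBound
    { toFun := fun x => U.cutoff h ⟨_, eval_mem_Θ x⟩
      map_add' := fun x y => map_add (U.cutoff h) ⟨_, eval_mem_Θ x⟩ ⟨_, eval_mem_Θ y⟩
      map_smul' := fun k x => map_smul (U.cutoff h) k ⟨_, eval_mem_Θ x⟩ } <| by
    obtain ⟨C, hC⟩ := h.hasCompactSupport.exists_bound_of_continuous h.continuous
    refine ⟨|C|, fun x => norm_le_of_eval_le (by positivity) fun t => ?_⟩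
    refine (norm_smul_le (h t) (U.eval t x)).trans ?_
    exact mul_le_mul ((hC t).trans (le_abs_self C)) (norm_eval_le t x) (norm_nonneg _)
      (abs_nonneg C)

theorem eval_cutoffL (h : C_c(Ω, ℂ)) (x : U.sectionAlgebra) (t : Ω) :
    U.eval t (U.cutoffL h x) = h t • U.eval t x := rfl

end Cutoff

variable [∀ t, IsScalarTower ℂ (A t) (A t)] [∀ t, SMulCommClass ℂ (A t) (A t)]
  {σ : Side}

theorem eval_mul (t : Ω) (x y : U.sectionAlgebra) :
    U.eval t (σ.mul _ x y) = σ.mul _ (U.eval t x) (U.eval t y) :=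
  σ.map_mul (fun _ _ => rfl) x y

section Products

variable [T2Space Ω]

theorem cutoffL_mul (h : C_c(Ω, ℂ)) (x y : U.sectionAlgebra) :
    U.cutoffL h (σ.mul _ x y) = σ.mul _ (U.cutoffL h x) y :=
  ext_eval fun t => by simp only [eval_cutoffL, eval_mul, map_smul, smul_apply]

theorem cutoff_mul_mem_closedSpan₂ (h : C_c(Ω, ℂ)) (x y : U.Θ) :
    U.cutoff (h * h) (x * y) ∈ closedSpan₂ (σ.mul U.sectionAlgebra) := by
  have key : U.cutoff (h * h) (x * y) = U.cutoff h x * U.cutoff h y :=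
    ext_eval fun t => (smul_mul_smul_comm (h t) (x.1 t) (h t) (y.1 t)).symm
  rw [key]
  cases σ
  · exact apply_mem_closedSpan₂ (τ := Side.left.mul _) (U.cutoff h x) (U.cutoff h y)
  · exact apply_mem_closedSpan₂ (τ := Side.right.mul _) (U.cutoff h y) (U.cutoff h x)

theorem exists_cutoff_mem_closedSpan₂ (σ : Side) (h : C_c(Ω, ℂ)) {q : ∀ t, A t}
    (hq : q ∈ U.thetaSq) :
    ∃ q' : U.Θ, q'.1 = q ∧ U.cutoff (h * h) q' ∈ closedSpan₂ (σ.mul U.sectionAlgebra) := by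
  induction hq using Submodule.span_induction with
  | mem q hq =>
    obtain ⟨x, hx, y, hy, rfl⟩ := hq
    exact ⟨⟨x, hx⟩ * ⟨y, hy⟩, rfl, cutoff_mul_mem_closedSpan₂ h _ _⟩
  | zero => exact ⟨0, rfl, by rw [map_zero]; exact zero_mem _⟩
  | add _ _ _ _ ih ih' =>
    obtain ⟨x, rfl, hx⟩ := ih
    obtain ⟨y, rfl, hy⟩ := ih'
    exact ⟨x + y, rfl, by rw [map_add]; exact add_mem hx hy⟩
  | smul k _ _ ih =>
    obtain ⟨x, rfl, hx⟩ := ih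
    exact ⟨k • x, rfl, by rw [map_smul]; exact Submodule.smul_mem _ k hx⟩

theorem exists_mem_closedSpan₂_eqOn [LocallyCompactSpace Ω] (σ : Side) {p : ∀ t, A t}
    (hpΘ : p ∈ U.Θ) (hp : p ∈ U.closureThetaSq) {K : Set Ω} (hK : IsCompact K) :
    ∃ z ∈ closedSpan₂ (σ.mul U.sectionAlgebra), ∀ t ∈ K, U.eval t z = p t := by
  obtain ⟨h, hh1, -, hh⟩ := exists_bump hK isOpen_univ K.subset_univ
  refine ⟨U.cutoff (h * h) ⟨p, hpΘ⟩, ?_, fun t ht => ?_⟩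
  · refine isClosed_closedSpan₂.closure_subset (Metric.mem_closure_iff.2 fun ε hε => ?_)
    obtain ⟨_, hq, hpq⟩ := hp (tsupport h) h.hasCompactSupport (ε / 2) (half_pos hε)
    obtain ⟨q, rfl, hqz⟩ := exists_cutoff_mem_closedSpan₂ σ h hq
    refine ⟨_, hqz, ?_⟩
    rw [dist_eq_norm, ← map_sub]
    refine (norm_cutoff_le (fun t => ?_) (half_pos hε).le fun t ht => ?_).trans_lt
      (half_lt_self hε)
    · exact (norm_mul_le _ _).trans (mul_le_one₀ (hh t) (norm_nonneg _) (hh t))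
    · exact hpq t (subset_tsupport h fun h0 => ht (mul_eq_zero_of_left h0 _))
  · rw [eval_cutoff, CompactlySupportedContinuousMap.coe_mul, Pi.mul_apply, hh1 t ht, one_mul,
      one_smul]

end Products

section Splitting

set_option maxSynthPendingDepth 3

variable [T2Space Ω] {s t : Ω} {β : U.sectionAlgebra →L[ℂ] U.sectionAlgebra →L[ℂ] ℂ}
  {W : U.sectionAlgebra →L[ℂ] BilinFormDual U.sectionAlgebra}

theorem splitting_cutoffL (hW : IsSplitting (σ.mul U.sectionAlgebra) W) (h : C_c(Ω, ℂ))
    (hβ : β ∈ U.fiberForms s t) {z : U.sectionAlgebra}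
    (hz : z ∈ closedSpan₂ (σ.mul U.sectionAlgebra)) : W (U.cutoffL h z) β = h s * W z β :=
  hW.apply_map (cutoffL_mul h) (fun x => by
    rw [← map_smul]
    exact eq_of_mem_fiberForms hβ (by rw [map_smul, eval_cutoffL])) hz

variable [LocallyCompactSpace Ω]

theorem splitting_eq_zero_of_eval_eq_zero (hW : IsSplitting (σ.mul U.sectionAlgebra) W)
    (hβ : β ∈ U.fiberForms s t) {z : U.sectionAlgebra}
    (hz : z ∈ closedSpan₂ (σ.mul U.sectionAlgebra)) (hzs : U.eval s z = 0) : W z β = 0 := by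
  suffices ∀ ε > 0, ‖W z β‖ ≤ ‖W‖ * ε by
    have hlim : Tendsto (fun ε => ‖W‖ * ε) (𝓝[>] 0) (𝓝 0) :=
      ((continuous_const_mul _).tendsto' 0 0 (mul_zero _)).mono_left nhdsWithin_le_nhds
    exact norm_le_zero_iff.1 (ge_of_tendsto hlim (eventually_mem_nhdsWithin.mono this))
  intro ε hε
  obtain ⟨h, hs, hV, hh⟩ := exists_bump isCompact_singleton
    (isOpen_lt (U.continuous_norm _ (eval_mem_Θ z)) continuous_const)
    (Set.singleton_subset_iff.2 (show ‖U.eval s z‖ < ε by rwa [hzs, norm_zero]))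
  have norm_hz : ‖U.cutoffL h z‖ ≤ ε := norm_cutoff_le hh hε.le fun t ht =>
    (not_imp_comm.1 (hV t) ht).le
  calc ‖W z β‖ = ‖W (U.cutoffL h z) β‖ := by rw [splitting_cutoffL hW h hβ hz, hs s rfl, one_mul]
    _ ≤ ‖W (U.cutoffL h z)‖ := (W _).unit_le_opNorm β (norm_le_one_of_mem_fiberForms hβ)
    _ ≤ ‖W‖ * ε := W.le_opNorm_of_le norm_hz

theorem splitting_congr (hW : IsSplitting (σ.mul U.sectionAlgebra) W)
    (hβ : β ∈ U.fiberForms s t) {z z' : U.sectionAlgebra}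
    (hz : z ∈ closedSpan₂ (σ.mul U.sectionAlgebra))
    (hz' : z' ∈ closedSpan₂ (σ.mul U.sectionAlgebra)) (h : U.eval s z = U.eval s z') :
    W z β = W z' β := by
  have := splitting_eq_zero_of_eval_eq_zero hW hβ (sub_mem hz hz') (by rw [map_sub, h, sub_self])
  rwa [map_sub, sub_apply, sub_eq_zero] at this

/-- The pairs `(s, t)` for which the splitting `W` of some `z` with `z s = p s` takes, on a form in
`fiberForms s t`, a value of more than half the norm of `p s`. -/
def linkedPairs (U : ContinuousField Ω A) (σ : Side)
    (W : U.sectionAlgebra →L[ℂ] BilinFormDual U.sectionAlgebra) (p : ∀ t, A t) : Set (Ω × Ω) :=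
  {q | ∃ z ∈ closedSpan₂ (σ.mul U.sectionAlgebra), U.eval q.1 z = p q.1 ∧
    ∃ β ∈ U.fiberForms q.1 q.2, ‖p q.1‖ / 2 < ‖W z β‖}

variable {p : ∀ t, A t}

theorem exists_isCompact_of_linkedPairs (hW : IsSplitting (σ.mul U.sectionAlgebra) W)
    (hpΘ : p ∈ U.Θ) (hp : p ∈ U.closureThetaSq) (hp0 : ∀ t, p t ≠ 0) {K : Set Ω}
    (hK : IsCompact K) :
    ∃ L, IsCompact L ∧ ∀ s ∈ K, ∀ t, (s, t) ∈ U.linkedPairs σ W p → t ∈ L := by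
  obtain ⟨z, hz, hzp⟩ := exists_mem_closedSpan₂_eqOn σ hpΘ hp hK
  obtain ⟨m, hm, hmp⟩ := hK.exists_forall_le' (U.continuous_norm p hpΘ).continuousOn
    fun t _ => norm_pos_iff.2 (hp0 t)
  obtain ⟨L, hL, hLW⟩ := mem_cocompact.1
    (eventually_forall_fiberForms_norm_lt (hW.mem_closedSpan₂ z) (half_pos hm))
  refine ⟨L, hL, fun s hs t hst => ?_⟩
  obtain ⟨z', hz', hz's, β, hβ, hlt⟩ := hst
  by_contra ht
  have upper : ‖W z β‖ < m / 2 := hLW ht s β hβ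
  have lower : ‖p s‖ / 2 < ‖W z β‖ := by
    rwa [splitting_congr hW hβ hz hz' ((hzp s hs).trans hz's.symm)]
  linarith [hmp s hs]

end Splitting

section Diagonal

set_option maxSynthPendingDepth 3

theorem IsLocallySubtrivial.exists_fiberForms (hU : U.IsLocallySubtrivial) (σ : Side) {t₀ : Ω}
    (a : A t₀) :
    ∃ (f : A t₀ →L[ℂ] ℂ) (β : Ω × Ω → U.sectionAlgebra →L[ℂ] U.sectionAlgebra →L[ℂ] ℂ),
      ‖f a‖ = ‖a‖ ∧ (∀ q, β q ∈ U.fiberForms q.1 q.2) ∧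
      ∀ x y, Tendsto (fun q => β q x y) (𝓝 (t₀, t₀)) (𝓝 (f (U.eval t₀ (σ.mul _ x y)))) := by
  obtain ⟨V, hV, ht₀, B, _, _, _, _, φ, φ_mul, φ_cont⟩ := hU t₀
  obtain ⟨g, hg, hga⟩ := exists_dual_vector'' ℂ (φ ⟨t₀, ht₀⟩ a)
  let ι : V × V → Ω × Ω := Prod.map (↑) (↑)
  have hι : IsOpenEmbedding ι := hV.isOpenEmbedding_subtypeVal.prodMap hV.isOpenEmbedding_subtypeVal
  let β₀ (q : V × V) := U.productForm σ g (φ q.1).toContinuousLinearMap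
    (φ q.2).toContinuousLinearMap
  have β₀_cont (x y : U.sectionAlgebra) : Continuous fun q => β₀ q x y := by
    have hx := (φ_cont _ (eval_mem_Θ x)).comp (continuous_fst (Y := V))
    have hy := (φ_cont _ (eval_mem_Θ y)).comp (continuous_snd (X := V))
    exact g.continuous.comp ((σ.mul B).continuous₂.comp (hx.prodMk hy))
  refine ⟨g.comp (φ ⟨t₀, ht₀⟩).toContinuousLinearMap, Function.extend ι β₀ 0, ?_, fun q => ?_,
    fun x y => ?_⟩
  · change ‖g (φ ⟨t₀, ht₀⟩ a)‖ = ‖a‖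
    rw [hga, LinearIsometry.norm_map, RCLike.norm_ofReal, abs_norm]
  · by_cases hq : ∃ q', ι q' = q
    · obtain ⟨q', rfl⟩ := hq
      rw [hι.injective.extend_apply]
      exact productForm_mem_fiberForms σ hg _ _
    · rw [Function.extend_apply' _ _ _ hq]
      intro x y
      simpa using by positivity
  · rw [show (t₀, t₀) = ι (⟨t₀, ht₀⟩, ⟨t₀, ht₀⟩) from rfl, ← hι.map_nhds_eq, tendsto_map'_iff]
    simp only [Function.comp_def, hι.injective.extend_apply]
    have hdiag : β₀ (⟨t₀, ht₀⟩, ⟨t₀, ht₀⟩) x y = g (φ ⟨t₀, ht₀⟩ (U.eval t₀ (σ.mul _ x y))) := by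
      rw [eval_mul, σ.map_mul (φ_mul _)]
      rfl
    exact hdiag ▸ (β₀_cont x y).tendsto _

variable [T2Space Ω] [LocallyCompactSpace Ω]
  {W : U.sectionAlgebra →L[ℂ] BilinFormDual U.sectionAlgebra} {p : ∀ t, A t}

theorem linkedPairs_mem_nhdsSet_diagonal (hU : U.IsLocallySubtrivial)
    (hW : IsSplitting (σ.mul U.sectionAlgebra) W) (hpΘ : p ∈ U.Θ) (hp : p ∈ U.closureThetaSq)
    (hp0 : ∀ t, p t ≠ 0) : U.linkedPairs σ W p ∈ 𝓝ˢ (Set.diagonal Ω) := by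
  rw [mem_nhdsSet_iff_forall]
  rintro ⟨t₀, t⟩ (rfl : t₀ = t)
  obtain ⟨K, hK, hKt₀⟩ := exists_compact_mem_nhds t₀
  obtain ⟨z, hz, hzp⟩ := exists_mem_closedSpan₂_eqOn σ hpΘ hp hK
  obtain ⟨f, β, hf, hβ, hlim⟩ := hU.exists_fiberForms σ (p t₀)
  have W_tendsto : Tendsto (fun q => ‖W z (β q)‖) (𝓝 (t₀, t₀)) (𝓝 ‖p t₀‖) := by
    have := tendsto_apply_of_mem_closedSpan₂ (hW.mem_closedSpan₂ z)
      (β₀ := formOfProduct (σ.mul _) (f.comp (U.eval t₀)))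
      (fun q => norm_le_one_of_mem_fiberForms (hβ q)) hlim
    rw [hW.apply_eq _ hz] at this
    simpa only [ContinuousLinearMap.comp_apply, hzp t₀ (mem_of_mem_nhds hKt₀), hf] using this.norm
  have p_tendsto : Tendsto (fun q : Ω × Ω => ‖p q.1‖ / 2) (𝓝 (t₀, t₀)) (𝓝 (‖p t₀‖ / 2)) :=
    (((U.continuous_norm p hpΘ).comp continuous_fst).div_const 2).tendsto (t₀, t₀)
  filter_upwards [p_tendsto.eventually_lt W_tendsto (half_lt_self (norm_pos_iff.2 (hp0 t₀))),
    continuous_fst.tendsto (t₀, t₀) hKt₀] with q hlt hqK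
  exact ⟨z, hz, hzp q.1 hqK, β q, hβ q, hlt⟩

end Diagonal

end ContinuousField

theorem theorem4p7_general {Ω : Type*} [TopologicalSpace Ω] [T2Space Ω] [LocallyCompactSpace Ω]
    {A : Ω → Type*} [∀ t, NonUnitalNormedRing (A t)] [∀ t, NormedSpace ℂ (A t)]
    [∀ t, IsScalarTower ℂ (A t) (A t)] [∀ t, SMulCommClass ℂ (A t) (A t)]
    [∀ t, CompleteSpace (A t)]
    (U : ContinuousField Ω A) (hU : U.IsLocallySubtrivial)
    (hproj : IsLeftProjectiveBanachAlgebra U.sectionAlgebra ∨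
      IsRightProjectiveBanachAlgebra U.sectionAlgebra)
    (p : ∀ t, A t) (hpΘ : p ∈ U.Θ) (hp : p ∈ U.closureThetaSq) (hp0 : ∀ t, p t ≠ 0) :
    ParacompactSpace Ω := by
  obtain ⟨σ, hσ⟩ := Side.exists_isProjectiveFor_mul hproj
  obtain ⟨W, hW⟩ := hσ.exists_isSplitting σ.mul_assoc
  exact paracompactSpace_of_mem_nhdsSet_diagonal
    (ContinuousField.linkedPairs_mem_nhdsSet_diagonal hU hW hpΘ hp hp0)
    fun K hK => ContinuousField.exists_isCompact_of_linkedPairs hW hpΘ hp hp0 hK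

theorem theorem4p7 {Ω : Type*} [TopologicalSpace Ω] [T2Space Ω] [LocallyCompactSpace Ω]
    {A : Ω → Type*} [∀ t, NonUnitalNormedRing (A t)] [∀ t, NormedSpace ℂ (A t)]
    [∀ t, IsScalarTower ℂ (A t) (A t)] [∀ t, SMulCommClass ℂ (A t) (A t)]
    [∀ t, CompleteSpace (A t)]
    (U : ContinuousField Ω A) (hU : U.IsLocallyTrivial)
    (hproj : IsLeftProjectiveBanachAlgebra U.sectionAlgebra ∨
      IsRightProjectiveBanachAlgebra U.sectionAlgebra)
    (p : ∀ t, A t) (hpΘ : p ∈ U.Θ) (hp : p ∈ U.closureThetaSq) (hp0 : ∀ t, p t ≠ 0)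
    (hpb : BddAbove (Set.range fun t => ‖p t‖)) :
    ParacompactSpace Ω :=
  theorem4p7_general U hU.isLocallySubtrivial hproj p hpΘ hp hp0
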